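/- **Setting.** A causal diagram $G$ is a finite acyclic directed graph whose nodes are observed (endogenous) variables $\mathbf V$ and exogenous variables $\mathbf U$, where exogenous variables have no parents (an exogenous variable may be a parent of several observed ones). A probabilistic causal model with diagram $G$ consists of finite domains, a structural equation $F_V : Dom(\mathbf{Pa}_{\mathbf V}(V)) \times Dom(\mathbf{Pa}_{\mathbf U}(V)) \to Dom(V)$ for each $V \in \mathbf V$, and a distribution $\Pr(\mathbf u)$ under which the exogenous variables are mutually independent. For $\mathbf X \subseteq \mathbf V$ and $\mathbf x \in Dom(\mathbf X)$, $\mathbf V_{\mathbf X\leftarrow \mathbf x}(\mathbf u)$ is the solution of the equations after those of $\mathbf X$ are replaced by the constants $\mathbf x$. An algorithm $f : Dom(\mathbf I) \to Dom(O)$ with inputs $\mathbf I \subseteq \mathbf V$ makes a binary decision $O \in \{o, o'\}$, $o > o'$; thus $O(\mathbf u) = f(\mathbf I(\mathbf u))$ and $O_{\mathbf X\leftarrow \mathbf x}(\mathbf u) = f(\mathbf I_{\mathbf X\leftarrow \mathbf x}(\mathbf u))$; $o_{\mathbf X\leftarrow\mathbf x}$ abbreviates $O_{\mathbf X\leftarrow\mathbf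 x}=o$, and likewise for $o'$. For disjoint $\mathbf K, \mathbf X\subseteq \mathbf V$, $\mathbf k \in Dom(\mathbf K)$ and $\mathbf x, \mathbf x' \in Dom(\mathbf X)$, the explanation scores are $$\mathrm{Nec}_{\mathbf x}(\mathbf k) = \Pr(o'_{\mathbf X\leftarrow \mathbf x'} \mid \mathbf x, o, \mathbf k),\quad \mathrm{Suf}_{\mathbf x}(\mathbf k) = \Pr(o_{\mathbf X\leftarrow \mathbf x} \mid \mathbf x', o', \mathbf k),\quad \mathrm{NeSuf}_{\mathbf x}(\mathbf k) = \Pr(o_{\mathbf X\leftarrow \mathbf x}, o'_{\mathbf X\leftarrow \mathbf x'} \mid \mathbf k).$$ The algorithm is monotone relative to $\mathbf x > \mathbf x'$ if $O_{\mathbf X\leftarrow \mathbf x}(\mathbf u) \ge O_{\mathbf X\leftarrow \mathbf x'}(\mathbf u)$ for every $\mathbf u$ with $\Pr(\mathbf u) > 0$. A set $\mathbf Z\subseteq\mathbf V$ satisfies the backdoor criterion relative to $\mathbf X$ and $\mathbf Y$ in $G$ if no element of $\mathbf Z$ is a descendant of an element of $\mathbf X$ and, for all $X \in \mathbf X$,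 $Y \in \mathbf Y$, $\mathbf Z$ blocks (in the sense of d-separation) every path of $G$ between $X$ and $Y$ that contains an arrow into $X$. **Proposition.** Let $f$ be monotone relative to $\mathbf x > \mathbf x'$, and let $\mathbf C \subseteq \mathbf V - (\mathbf K \cup \mathbf X)$ be such that $\mathbf C \cup \mathbf K$ satisfies the backdoor criterion relative to $\mathbf X$ and $\mathbf I$ in $G$; here it is enough to consider the inputs in $\mathbf I \setminus (\mathbf X \cup \mathbf C \cup \mathbf K)$, those that are neither intervened on nor conditioned on. Then the following hold, where terms with weight $\Pr(\mathbf c\mid\cdot)=0$ are read as $0$. 1. If $\Pr(\mathbf x, o, \mathbf k) > 0$, and $\Pr(\mathbf c, \mathbf x', \mathbf k) > 0$ for all $\mathbf c$ with $\Pr(\mathbf c, \mathbf x, \mathbf k) > 0$, then $$\mathrm{Nec}_{\mathbf x}(\mathbf k) = \frac{\Big(\sum_{\mathbf c \in Dom(\mathbf C)} \Pr(o' \mid \mathbf c, \mathbf x', \mathbf k)\Pr(\mathbf c \mid \mathbf x, \mathbf k)\Big) - \Pr(o' \mid \mathbf x, \mathbf k)}{\Pr(o \mid \mathbf x, \mathbf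 k)}.$$ 2. If $\Pr(\mathbf x', o', \mathbf k) > 0$, and $\Pr(\mathbf c, \mathbf x, \mathbf k) > 0$ for all $\mathbf c$ with $\Pr(\mathbf c, \mathbf x', \mathbf k) > 0$, then $$\mathrm{Suf}_{\mathbf x}(\mathbf k) = \frac{\Big(\sum_{\mathbf c \in Dom(\mathbf C)} \Pr(o \mid \mathbf c, \mathbf x, \mathbf k)\Pr(\mathbf c \mid \mathbf x', \mathbf k)\Big) - \Pr(o \mid \mathbf x', \mathbf k)}{\Pr(o' \mid \mathbf x', \mathbf k)}.$$ 3. If $\Pr(\mathbf k) > 0$, and $\Pr(\mathbf c, \mathbf x, \mathbf k) > 0$ and $\Pr(\mathbf c, \mathbf x', \mathbf k) > 0$ for all $\mathbf c$ with $\Pr(\mathbf c, \mathbf k) > 0$, then $$\mathrm{NeSuf}_{\mathbf x}(\mathbf k) = \sum_{\mathbf c \in Dom(\mathbf C)} \big(\Pr(o \mid \mathbf c, \mathbf x, \mathbf k) - \Pr(o \mid \mathbf c, \mathbf x', \mathbf k)\big)\Pr(\mathbf c \mid \mathbf k).$$ -/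

import Mathlib

universe u₁ u₂ u₃ u₄

/-- A causal diagram with endogenous (observed) variables `V` and exogenous variables `U`: every
endogenous variable has a set of endogenous parents and a set of exogenous parents, and there is
no directed cycle. Exogenous variables have no parents; one exogenous variable may be a parent of
several endogenous ones (an unobserved common cause). -/
structure CausalDiagram (V : Type u₁) (U : Type u₂) where
  /-- endogenous parents -/
  paV : V → Finset V
  /-- exogenous parents -/
  paU : V → Finset U
  /-- no directed cycle -/
  acyclic : ∀ v, ¬ Relation.TransGen (fun a b => a ∈ paV b) v v

namespace CausalDiagram

variable {V : Type u₁} {U : Type u₂} (G : CausalDiagram V U)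

/-- `G.Edge a b`: there is an arrow `a → b` in the diagram. The nodes are the endogenous variables
`Sum.inl v` and the exogenous variables `Sum.inr i`. -/
def Edge : V ⊕ U → V ⊕ U → Prop
  | Sum.inl w, Sum.inl v => w ∈ G.paV v
  | Sum.inr i, Sum.inl v => i ∈ G.paU v
  | _, Sum.inr _ => False

/-- The skeleton of the diagram: the undirected graph that forgets the direction of arrows. -/
def skeleton : SimpleGraph (V ⊕ U) := SimpleGraph.fromRel G.Edge

/-- `b` is a descendant of `a`: there is a directed path with at least one arrow from `a` to
`b`. -/
def Descendant (a b : V ⊕ U) : Prop := Relation.TransGen G.Edge a b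

/-- The set `Z` of observed variables blocks the path `p` (d-separation): `p` has an inner node
`m`, with neighbours `a`, `b` on `p`, such that either `m` is not a collider on `p` and `m ∈ Z`,
or `m` is a collider (`a → m ← b`) and neither `m` nor a descendant of `m` is in `Z`. -/
def Blocks (Z : Finset V) {s t : V ⊕ U} (p : G.skeleton.Walk s t) : Prop :=
  ∃ i : ℕ, i + 2 ≤ p.length ∧
    ((¬ (G.Edge (p.getVert i) (p.getVert (i + 1)) ∧
          G.Edge (p.getVert (i + 2)) (p.getVert (i + 1))) ∧
        ∃ z ∈ Z, p.getVert (i + 1) = Sum.inl z) ∨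
     ((G.Edge (p.getVert i) (p.getVert (i + 1)) ∧
          G.Edge (p.getVert (i + 2)) (p.getVert (i + 1))) ∧
        ∀ z ∈ Z, p.getVert (i + 1) ≠ Sum.inl z ∧
          ¬ G.Descendant (p.getVert (i + 1)) (Sum.inl z)))

/-- A path is a back-door path if its first edge is an arrow into its first node. -/
def IsBackdoor {s t : V ⊕ U} (p : G.skeleton.Walk s t) : Prop :=
  p.IsPath ∧ 0 < p.length ∧ G.Edge (p.getVert 1) (p.getVert 0)

/-- `Z` satisfies the back-door criterion relative to `(X, Y)`: for all `a ∈ X` and `b ∈ Y`, no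
element of `Z` is a descendant of `a`, and `Z` blocks every path from `a` to `b` that has an arrow
into `a`. -/
def BackdoorCriterion (X Y Z : Finset V) : Prop :=
  (∀ a ∈ X, ∀ z ∈ Z, ¬ G.Descendant (Sum.inl a) (Sum.inl z)) ∧
  (∀ a ∈ X, ∀ b ∈ Y, ∀ p : G.skeleton.Walk (Sum.inl a) (Sum.inl b),
    G.IsBackdoor p → G.Blocks Z p)

theorem wf_paV [Finite V] : WellFounded (fun a b : V => a ∈ G.paV b) := by
  have : IsTrans V (Relation.TransGen (fun a b : V => a ∈ G.paV b)) :=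
    ⟨fun _ _ _ h h' => h.trans h'⟩
  have : Std.Irrefl (Relation.TransGen (fun a b : V => a ∈ G.paV b)) := ⟨G.acyclic⟩
  exact Subrelation.wf (fun h => Relation.TransGen.single h)
    (Finite.wellFounded_of_trans_of_irrefl (Relation.TransGen (fun a b : V => a ∈ G.paV b)))

end CausalDiagram

/-- `Dom(S)`: the joint assignments of values to the variables in the set `S`. -/
abbrev DomOf {V : Type u₁} (Dom : V → Type u₃) (S : Finset V) : Type (max u₁ u₃) :=
  (v : S) → Dom v

/-- A probabilistic causal model with causal diagram `G`: a structural equation for every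
endogenous variable, and a joint distribution of the exogenous variables. -/
structure PCM {V : Type u₁} {U : Type u₂} (G : CausalDiagram V U)
    (Dom : V → Type u₃) (DomU : U → Type u₄) where
  /-- structural equations -/
  F : (v : V) → ((w : G.paV v) → Dom w) → ((i : G.paU v) → DomU i) → Dom v
  /-- distribution of the exogenous variables -/
  prob : PMF ((i : U) → DomU i)

namespace PCM

variable {V : Type u₁} {U : Type u₂} {G : CausalDiagram V U}
  {Dom : V → Type u₃} {DomU : U → Type u₄}

/-- The exogenous variables are mutually independent: their joint distribution is the product of
the marginal distributions. -/
def ExogenousIndependent [Fintype U] (M : PCM G Dom DomU) : Prop :=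
  ∀ u : (i : U) → DomU i, M.prob u = ∏ i, (M.prob.map (fun w => w i)) (u i)

section Outcomes

variable [Finite V] [DecidableEq V] (M : PCM G Dom DomU)

/-- The values `V_{X ← x}(u)` of the endogenous variables in the context `u` after the intervention
`X ← x`: the solution of the structural equations in which those of the variables in `X` are
replaced by the constants `x`. -/
noncomputable def potential (X : Finset V) (x : DomOf Dom X) (u : (i : U) → DomU i) :
    (v : V) → Dom v :=
  G.wf_paV.fix (fun v ih =>
    if h : v ∈ X then x ⟨v, h⟩ else M.F v (fun w => ih w w.2) (fun i => u i))

theorem potential_eq (X : Finset V) (x : DomOf Dom X) (u : (i : U) → DomU i) (v : V) :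
    M.potential X x u v =
      if h : v ∈ X then x ⟨v, h⟩ else M.F v (fun w => M.potential X x u w) (fun i => u i) := by
  unfold potential
  rw [WellFounded.fix_eq]

/-- The values of the endogenous variables in the context `u` without intervention. -/
noncomputable def observed (u : (i : U) → DomU i) : (v : V) → Dom v :=
  M.potential ∅ (fun v => (Finset.notMem_empty _ v.2).elim) u

/-- The event `S = s`. -/
def ev (S : Finset V) (s : DomOf Dom S) : Set ((i : U) → DomU i) :=
  {u | S.restrict (M.observed u) = s}

/-- The event `O = d` that the algorithm `f` with inputs `I` makes the decision `d`
(`true` is the positive decision `o`, `false` the negative decision `o'`). -/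
def decEv {I : Finset V} (f : DomOf Dom I → Bool) (d : Bool) : Set ((i : U) → DomU i) :=
  {u | f (I.restrict (M.observed u)) = d}

/-- The event `O_{X ← x} = d` that `f` would make the decision `d` after the intervention
`X ← x`. -/
def decEvDo {I : Finset V} (f : DomOf Dom I → Bool) (X : Finset V) (x : DomOf Dom X) (d : Bool) :
    Set ((i : U) → DomU i) :=
  {u | f (I.restrict (M.potential X x u)) = d}

/-- The algorithm `f` is monotone relative to the larger value `x` and the smaller value `x'`
of `X`: `O_{X ← x} ≥ O_{X ← x'}` in every context of positive probability. -/
def MonotoneRel {I : Finset V} (f : DomOf Dom I → Bool) (X : Finset V) (x x' : DomOf Dom X) :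
    Prop :=
  ∀ u, M.prob u ≠ 0 →
    f (I.restrict (M.potential X x' u)) ≤ f (I.restrict (M.potential X x u))

end Outcomes

section Probability

variable [Fintype U] [DecidableEq U] [∀ i, Fintype (DomU i)] (M : PCM G Dom DomU)

/-- The probability of an event. -/
noncomputable def Pr (A : Set ((i : U) → DomU i)) : ℝ :=
  ∑ u, A.indicator (fun u => (M.prob u).toReal) u

/-- The conditional probability `Pr(A | B)`; it is meaningful only if `Pr(B) > 0`. -/
noncomputable def condPr (A B : Set ((i : U) → DomU i)) : ℝ := M.Pr (A ∩ B) / M.Pr B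

variable [Finite V] [DecidableEq V]

/-- The necessity score `Pr(o'_{X ← x'} | x, o, k)`. -/
noncomputable def Nec {I : Finset V} (f : DomOf Dom I → Bool) {X K : Finset V}
    (x x' : DomOf Dom X) (k : DomOf Dom K) : ℝ :=
  M.condPr (M.decEvDo f X x' false) (M.ev X x ∩ M.decEv f true ∩ M.ev K k)

/-- The sufficiency score `Pr(o_{X ← x} | x', o', k)`. -/
noncomputable def Suf {I : Finset V} (f : DomOf Dom I → Bool) {X K : Finset V}
    (x x' : DomOf Dom X) (k : DomOf Dom K) : ℝ :=
  M.condPr (M.decEvDo f X x true) (M.ev X x' ∩ M.decEv f false ∩ M.ev K k)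

/-- The necessity and sufficiency score `Pr(o_{X ← x}, o'_{X ← x'} | k)`. -/
noncomputable def NeSuf {I : Finset V} (f : DomOf Dom I → Bool) {X K : Finset V}
    (x x' : DomOf Dom X) (k : DomOf Dom K) : ℝ :=
  M.condPr (M.decEvDo f X x true ∩ M.decEvDo f X x' false) (M.ev K k)

end Probability

end PCM

/-! ### Acyclicity of the diagram on all nodes. -/

namespace CausalDiagram

variable {V : Type u₁} {U : Type u₂} (G : CausalDiagram V U)

/-! Write `Z` for `C ∪ K`. The heart of the proof is that, given `Z`, the counterfactual decision
`O_{X ← x₀}` is independent of the observed `X`. This is obtained from the structural equations, not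
from a general d-separation theorem.

Explore the diagram from `X` backwards along active walks (`Reach`), and let `S` be the set of
exogenous variables so reached. The event that `X` and `Z` take given values is a conjunction of
conditions on single equations, each evaluated with `X ∪ Z` held fixed (`observed_eq_on_iff`). The
equations of `X`, and those of the nodes of `Z` entered by an active walk, involve only noise in
`S`; the other equations of `Z`, and the decision itself, involve only noise outside `S`, because
the back-door criterion forbids reaching an input. As the exogenous variables are independent, the
probabilities factor as `α(x) β` and `α(x) γ` (`exists_factorization`), and `α(x)` cancels in
conditional probabilities. The criterion speaks of paths while exploration yields walks, so cycles
must be cut out of active walks (`shortcut`).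

This gives adjustment formulas for `O_{X ← x}` given `k`, or given `k` and another treatment. Since
monotonicity lets an intervention change the decision in one direction only, each joint probability
of two counterfactual decisions is a difference of single ones (`Pr_decEvDo_inter_decEvDo`), and
consistency replaces `O_{X ← x}` by `O` where `X = x` is observed. -/

theorem exists_eq_inl_of_edge {G : CausalDiagram V U} {m n : V ⊕ U} (h : G.Edge m n) :
    ∃ v, n = Sum.inl v := by
  cases n with
  | inl v => exact ⟨v, rfl⟩
  | inr i => cases m <;> exact h.elim

theorem transGen_paV_of_descendant {G : CausalDiagram V U} {v w : V}
    (h : G.Descendant (Sum.inl w) (Sum.inl v)) :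
    Relation.TransGen (fun a b => a ∈ G.paV b) w v := by
  have key : ∀ m, Relation.TransGen G.Edge (Sum.inl w) m → ∀ v, m = Sum.inl v →
      Relation.TransGen (fun a b => a ∈ G.paV b) w v := by
    intro m hm
    induction hm with
    | single e => rintro v rfl; exact .single e
    | @tail b c h e ih =>
      rintro v rfl
      obtain ⟨b', rfl⟩ : ∃ v, b = Sum.inl v := by
        cases h with
        | single e => exact exists_eq_inl_of_edge e
        | tail _ e => exact exists_eq_inl_of_edge e
      exact (ih b' rfl).tail e
  exact key _ h v rfl

theorem not_descendant_self (m : V ⊕ U) : ¬ G.Descendant m m := by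
  intro h
  obtain ⟨v, rfl⟩ : ∃ v, m = Sum.inl v := by
    cases h with
    | single e => exact exists_eq_inl_of_edge e
    | tail _ e => exact exists_eq_inl_of_edge e
  exact G.acyclic v (transGen_paV_of_descendant h)

theorem edge_asymm {G : CausalDiagram V U} {m n : V ⊕ U} (h : G.Edge m n) : ¬ G.Edge n m :=
  fun h' => G.not_descendant_self m ((Relation.TransGen.single h).tail h')

/-! ### Active walks, and their reduction to unblocked back-door paths. -/

/-- The triple `l - m - r` of consecutive nodes does not block a walk, given `Z`. -/
def ActiveTriple (Z : Finset V) (l m r : V ⊕ U) : Prop :=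
  (¬ (G.Edge l m ∧ G.Edge r m) → ∀ z ∈ Z, m ≠ Sum.inl z) ∧
  (G.Edge l m ∧ G.Edge r m → ∃ z ∈ Z, m = Sum.inl z ∨ G.Descendant m (Sum.inl z))

/-- The first `n + 1` values of `w` form a walk that starts at a node of `X` with an arrow into it,
does not return to `X`, and is not blocked by `Z`. -/
structure IsActiveWalk (X Z : Finset V) (n : ℕ) (w : ℕ → V ⊕ U) : Prop where
  pos : 0 < n
  start : ∃ a ∈ X, w 0 = Sum.inl a
  first : G.Edge (w 1) (w 0)
  adj : ∀ i < n, G.Edge (w i) (w (i + 1)) ∨ G.Edge (w (i + 1)) (w i)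
  avoid : ∀ i, 0 < i → i ≤ n → ∀ a ∈ X, w i ≠ Sum.inl a
  active : ∀ i, i + 2 ≤ n → G.ActiveTriple Z (w i) (w (i + 1)) (w (i + 2))

/-- `G.Reach X Z m d`: the node `m` is the end of an active walk from `X`; its last arrow points
away from `m` if `d` is `true`, and into `m` if `d` is `false`. -/
inductive Reach (X Z : Finset V) : V ⊕ U → Bool → Prop
  | start {a : V} {m : V ⊕ U} : a ∈ X → G.Edge m (Sum.inl a) → (∀ v ∈ X, m ≠ Sum.inl v) →
      Reach X Z m true
  | up {m m' : V ⊕ U} : Reach X Z m true → (∀ z ∈ Z, m ≠ Sum.inl z) → G.Edge m' m →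
      (∀ v ∈ X, m' ≠ Sum.inl v) → Reach X Z m' true
  | down {m m' : V ⊕ U} {d : Bool} : Reach X Z m d → (∀ z ∈ Z, m ≠ Sum.inl z) → G.Edge m m' →
      (∀ v ∈ X, m' ≠ Sum.inl v) → Reach X Z m' false
  | collide {z : V} {m' : V ⊕ U} : Reach X Z (Sum.inl z) false → z ∈ Z → G.Edge m' (Sum.inl z) →
      (∀ v ∈ X, m' ≠ Sum.inl v) → Reach X Z m' true

variable {G} {X Z : Finset V}

theorem IsActiveWalk.extend {n : ℕ} {w : ℕ → V ⊕ U} (h : G.IsActiveWalk X Z (n + 1) w)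
    {m : V ⊕ U} (hm : G.Edge (w (n + 1)) m ∨ G.Edge m (w (n + 1)))
    (hX : ∀ v ∈ X, m ≠ Sum.inl v) (ht : G.ActiveTriple Z (w n) (w (n + 1)) m) :
    G.IsActiveWalk X Z (n + 2) (fun i => if i ≤ n + 1 then w i else m) where
  pos := by omega
  start := by simpa using h.start
  first := by simpa using h.first
  adj i hi := by
    rcases Nat.lt_or_ge i (n + 1) with h1 | h1
    · simpa [h1.le, Nat.succ_le_of_lt h1] using h.adj i h1
    · obtain rfl : i = n + 1 := by omega
      simpa using hm
  avoid i h0 hi := by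
    by_cases h1 : i ≤ n + 1
    · simpa [h1] using h.avoid i h0 h1
    · simpa [h1] using hX
  active i hi := by
    rcases Nat.lt_or_ge i n with h1 | h1
    · simpa [show i ≤ n + 1 by omega, show i ≤ n by omega, show i + 2 ≤ n + 1 by omega]
        using h.active i (by omega)
    · obtain rfl : i = n := by omega
      simpa using ht

theorem Reach.exists_isActiveWalk {m : V ⊕ U} {d : Bool} (h : G.Reach X Z m d) :
    ∃ n w, G.IsActiveWalk X Z (n + 1) w ∧ w (n + 1) = m ∧
      (d = true → G.Edge m (w n)) ∧ (d = false → G.Edge (w n) m) := by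
  induction h with
  | @start a m ha e hX =>
    refine ⟨0, fun i => if i = 0 then Sum.inl a else m, ⟨by simp, ⟨a, ha, by simp⟩, by simpa,
      fun i hi => ?_, fun i h0 hi => ?_, fun i hi => by omega⟩, by simp, by simpa, by simp⟩
    · obtain rfl : i = 0 := by omega
      simpa using Or.inr e
    · simpa [h0.ne'] using hX
  | @up m m' _ hZ e hX ih =>
    obtain ⟨n, w, hw, rfl, hd, -⟩ := ih
    refine ⟨n + 1, _, hw.extend (Or.inr e) hX ⟨fun _ => hZ, fun hc => ?_⟩, by simp,
      by simpa, by simp⟩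
    exact (edge_asymm (hd rfl) hc.1).elim
  | @down m m' d _ hZ e hX ih =>
    obtain ⟨n, w, hw, rfl, -, -⟩ := ih
    refine ⟨n + 1, _, hw.extend (Or.inl e) hX ⟨fun _ => hZ, fun hc => ?_⟩, by simp,
      by simp, by simpa⟩
    exact (edge_asymm e hc.2).elim
  | @collide z m' _ hz e hX ih =>
    obtain ⟨n, w, hw, hwz, -, hd⟩ := ih
    rw [← hwz] at e hd
    refine ⟨n + 1, _, hw.extend (Or.inr e) hX ⟨fun hc => (hc ⟨hd rfl, e⟩).elim,
      fun _ => ⟨z, hz, Or.inl hwz⟩⟩, by simp, by simpa, by simp⟩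

/-- A walk that leaves a node along an arrow and comes back to it meets a collider below that
node. -/
theorem IsActiveWalk.exists_descendant_of_cycle {n p q : ℕ} {w : ℕ → V ⊕ U}
    (h : G.IsActiveWalk X Z n w) (hpq : p < q) (hq : q ≤ n) (hw : w p = w q)
    (he : G.Edge (w p) (w (p + 1))) : ∃ z ∈ Z, G.Descendant (w p) (Sum.inl z) := by
  by_contra hno
  -- The first reversal of direction would be a collider below `w p`, and activity would put it or a
  -- descendant of it in `Z`. Without a reversal the walk is a directed cycle.
  have key : ∀ j, p + 1 + j ≤ q → G.Descendant (w p) (w (p + 1 + j)) ∧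
      G.Edge (w (p + j)) (w (p + 1 + j)) := by
    intro j
    induction j with
    | zero => exact fun _ => ⟨.single he, he⟩
    | succ j ih =>
      intro hj
      obtain ⟨hd, e⟩ := ih (by omega)
      have hidx : p + 1 + j = p + j + 1 := by omega
      rw [hidx] at hd e
      have hidx' : p + 1 + (j + 1) = p + j + 1 + 1 := by omega
      rw [hidx', ← add_assoc]
      rcases h.adj (p + j + 1) (by omega) with e' | e'
      · exact ⟨hd.tail e', e'⟩
      · obtain ⟨z, hz, hz' | hz'⟩ := (h.active (p + j) (by omega)).2 ⟨e, e'⟩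
        · exact (hno ⟨z, hz, hz' ▸ hd⟩).elim
        · exact (hno ⟨z, hz, hd.trans hz'⟩).elim
  have := (key (q - (p + 1)) (by omega)).1
  rw [show p + 1 + (q - (p + 1)) = q by omega, ← hw] at this
  exact G.not_descendant_self _ this

/-- The cycle between two visits of the same node can be cut out of an active walk. -/
theorem IsActiveWalk.shortcut {n p q : ℕ} {w : ℕ → V ⊕ U} (h : G.IsActiveWalk X Z n w)
    (hpq : p < q) (hq : q ≤ n) (hw : w p = w q) :
    G.IsActiveWalk X Z (n - (q - p)) (fun i => if i ≤ p then w i else w (i + (q - p))) := by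
  -- The start lies in `X`, which the walk never revisits; so the junction is an inner node or the
  -- end.
  have hp : 0 < p := by
    rcases Nat.eq_zero_or_pos p with rfl | hp
    · obtain ⟨a, ha, ha'⟩ := h.start
      exact (h.avoid q hpq hq a ha (hw ▸ ha')).elim
    · exact hp
  refine ⟨by omega, by simpa using h.start, ?_, fun i hi => ?_, fun i h0 hi => ?_, fun i hi => ?_⟩
  · simpa [Nat.succ_le_of_lt hp] using h.first
  · rcases lt_trichotomy i p with h1 | rfl | h1
    · simpa [h1.le, Nat.succ_le_of_lt h1] using h.adj i (by omega)
    · simpa [hw, show i + 1 + (q - i) = q + 1 by omega] using h.adj q (by omega)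
    · simpa [show ¬ i ≤ p by omega, show ¬ i < p by omega,
        show i + 1 + (q - p) = i + (q - p) + 1 by omega]
        using h.adj (i + (q - p)) (by omega)
  · by_cases h1 : i ≤ p
    · simpa [h1] using h.avoid i h0 (by omega)
    · simpa [h1] using h.avoid (i + (q - p)) (by omega) (by omega)
  · rcases lt_trichotomy (i + 1) p with h1 | rfl | h1
    · simpa [show i ≤ p by omega, h1.le, show i + 2 ≤ p by omega] using h.active i (by omega)
    -- The junction joins the left neighbour at time `p` to the right neighbour at time `q`. If it
    -- lies in `Z`, it was a collider at both visits, hence is one now. If it is now a collider,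
    -- then either it was one at time `p`, or the walk left it along an arrow and the removed cycle
    -- supplies a descendant in `Z`.
    · have hP := h.active i (by omega)
      have hQ := h.active (q - 1) (by omega)
      rw [show q - 1 + 1 = q by omega, show q - 1 + 2 = q + 1 by omega, ← hw] at hQ
      simp only [show i ≤ i + 1 by omega, le_refl, if_true, show ¬ i + 2 ≤ i + 1 by omega, if_false,
        show i + 2 + (q - (i + 1)) = q + 1 by omega]
      refine ⟨fun hn z hz hwz => ?_, fun hc => ?_⟩
      · have h1 := not_imp_comm.1 hP.1 fun hh => hh z hz hwz
        have h2 := not_imp_comm.1 hQ.1 fun hh => hh z hz hwz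
        exact hn ⟨h1.1, h2.2⟩
      · rcases h.adj (i + 1) (by omega) with e | e
        · obtain ⟨z, hz, hd⟩ := h.exists_descendant_of_cycle hpq hq hw e
          exact ⟨z, hz, Or.inr hd⟩
        · exact hP.2 ⟨hc.1, e⟩
    · rcases Nat.lt_or_ge p i with h2 | h2
      · simpa [show ¬ i ≤ p by omega, show ¬ i + 1 ≤ p by omega, show ¬ i + 2 ≤ p by omega,
          show ¬ i < p by omega,
          show i + 1 + (q - p) = i + (q - p) + 1 by omega,
          show i + 2 + (q - p) = i + (q - p) + 2 by omega] using h.active (i + (q - p)) (by omega)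
      · obtain rfl : i = p := by omega
        simpa [hw, show i + 1 + (q - i) = q + 1 by omega, show i + 2 + (q - i) = q + 2 by omega]
          using h.active q (by omega)

/-- Each repeated node allows a cut that strictly shortens the walk, so the process ends in a path.
A walk that descends to a node of `Z` and climbs back is thereby turned into a collider with a
descendant in `Z`; hence `Reach` needs to turn only at nodes of `Z`. -/
theorem IsActiveWalk.exists_injOn {n : ℕ} {w : ℕ → V ⊕ U} (h : G.IsActiveWalk X Z n w) :
    ∃ n' w', G.IsActiveWalk X Z n' w' ∧ w' n' = w n ∧ Set.InjOn w' {i | i ≤ n'} := by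
  induction n using Nat.strong_induction_on generalizing w with
  | _ n ih =>
    by_cases hinj : Set.InjOn w {i | i ≤ n}
    · exact ⟨n, w, h, rfl, hinj⟩
    · obtain ⟨p, q, hpq, hq, hw⟩ : ∃ p q, p < q ∧ q ≤ n ∧ w p = w q := by
        simp only [Set.InjOn, not_forall] at hinj
        obtain ⟨p, hp, q, hq, hw, hne⟩ := hinj
        rcases lt_or_gt_of_ne hne with h1 | h1
        · exact ⟨p, q, h1, hq, hw⟩
        · exact ⟨q, p, h1, hp, hw.symm⟩
      obtain ⟨n', w', h', he, hi⟩ := ih _ (by omega) (h.shortcut hpq hq hw)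
      refine ⟨n', w', h', he.trans ?_, hi⟩
      -- If the cycle ends at the last node, the cut walk stops at index `p`, where the value is the
      -- same.
      rcases hq.lt_or_eq with h1 | rfl
      · simp [show ¬ n - (q - p) ≤ p by omega, show n - (q - p) + (q - p) = n by omega]
      · simp [show q - (q - p) = p by omega, hw]

theorem _root_.SimpleGraph.exists_walk_getVert_eq {α : Type*} (H : SimpleGraph α) (w : ℕ → α)
    (n : ℕ) (h : ∀ i < n, H.Adj (w i) (w (i + 1))) :
    ∃ p : H.Walk (w 0) (w n), p.length = n ∧ ∀ i ≤ n, p.getVert i = w i := by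
  induction n generalizing w with
  | zero => exact ⟨.nil, rfl, fun i hi => by simp [Nat.le_zero.1 hi]⟩
  | succ n ih =>
    obtain ⟨p, hp, hv⟩ := ih (fun i => w (i + 1)) fun i hi => h (i + 1) (by omega)
    refine ⟨.cons (h 0 (by omega)) p, by simp [hp], fun i hi => ?_⟩
    cases i with
    | zero => simp
    | succ i => simpa using hv i (by omega)

theorem IsActiveWalk.exists_not_blocks {n : ℕ} {w : ℕ → V ⊕ U} {b : V}
    (h : G.IsActiveWalk X Z n w) (hb : w n = Sum.inl b) :
    ∃ a ∈ X, ∃ p : G.skeleton.Walk (Sum.inl a) (Sum.inl b), G.IsBackdoor p ∧ ¬ G.Blocks Z p := by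
  obtain ⟨n', w', h', he, hinj⟩ := h.exists_injOn
  obtain ⟨p, hp, hv⟩ := G.skeleton.exists_walk_getVert_eq w' n' fun i hi => by
    refine ⟨fun hne => ?_, h'.adj i hi⟩
    have := hinj (show i ≤ n' by omega) (show i + 1 ≤ n' by omega) hne
    omega
  obtain ⟨a, ha, h0⟩ := h'.start
  have hpos := h'.pos
  have hfirst := h'.first
  rw [← hv 0 (by omega), ← hv 1 (by omega)] at hfirst
  have hpath : p.IsPath := by
    rw [← SimpleGraph.Walk.IsPath.getVert_injOn_iff, hp]
    exact hinj.congr fun i hi => (hv i hi).symm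
  have hblock : ¬ G.Blocks Z p := by
    rintro ⟨i, hi, hc⟩
    rw [hv i (by omega), hv (i + 1) (by omega), hv (i + 2) (by omega)] at hc
    have ht := h'.active i (by omega)
    rcases hc with ⟨hn, z, hz, hwz⟩ | ⟨hc, hall⟩
    · exact ht.1 hn z hz hwz
    · obtain ⟨z, hz, hd | hd⟩ := ht.2 hc
      · exact (hall z hz).1 hd
      · exact (hall z hz).2 hd
  have hb' := he.trans hb
  refine ⟨a, ha, p.copy h0 hb', ?_, ?_⟩
  · refine ⟨by simpa using hpath, by simp [hp, hpos], by simpa [h0] using hfirst⟩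
  · unfold Blocks at hblock ⊢
    simpa using hblock

theorem BackdoorCriterion.not_reach {Y : Finset V} (h : G.BackdoorCriterion X Y Z) {b : V}
    (hb : b ∈ Y) (d : Bool) : ¬ G.Reach X Z (Sum.inl b) d := by
  intro hr
  obtain ⟨n, w, hw, he, -⟩ := hr.exists_isActiveWalk
  obtain ⟨a, ha, p, hp, hnb⟩ := hw.exists_not_blocks he
  exact hnb (h.2 a ha b hb p hp)

end CausalDiagram

namespace PCM

variable {V : Type u₁} {U : Type u₂} {G : CausalDiagram V U}
  {Dom : V → Type u₃} {DomU : U → Type u₄}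

/-! ### Solutions of the equations and the noise they depend on. -/

section Interventions

variable [Finite V] [DecidableEq V] (M : PCM G Dom DomU)

theorem potential_unique (X : Finset V) (x : DomOf Dom X) (u : (i : U) → DomU i)
    (g : (v : V) → Dom v)
    (h : ∀ v, g v = if h : v ∈ X then x ⟨v, h⟩ else M.F v (fun w => g w) (fun i => u i)) :
    M.potential X x u = g := by
  funext v
  induction v using G.wf_paV.induction with
  | _ v ih =>
    rw [potential_eq, h v]
    split_ifs
    · rfl
    · congr 1
      funext w
      exact ih w w.2

theorem observed_eq (u : (i : U) → DomU i) (v : V) :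
    M.observed u v = M.F v (fun w => M.observed u w) (fun i => u i) := by
  unfold observed
  rw [potential_eq]
  simp

/-- The value that the structural equation of `v` gives when the variables in `T` are set as in
`τ`; the variable `v` itself may belong to `T`. -/
noncomputable def natural (T : Finset V) (τ : (v : V) → Dom v) (u : (i : U) → DomU i) (v : V) :
    Dom v :=
  M.F v (fun w => M.potential T (T.restrict τ) u w) (fun i => u i)

theorem potential_restrict_of_mem {T : Finset V} (τ : (v : V) → Dom v) (u : (i : U) → DomU i)
    {v : V} (hv : v ∈ T) : M.potential T (T.restrict τ) u v = τ v := by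
  rw [potential_eq, dif_pos hv, Finset.restrict]

theorem potential_restrict_of_notMem {T : Finset V} (τ : (v : V) → Dom v)
    (u : (i : U) → DomU i) {v : V} (hv : v ∉ T) :
    M.potential T (T.restrict τ) u v = M.natural T τ u v := by
  rw [potential_eq, dif_neg hv, natural]

/-- If either side holds, the observed solution and the solution with `T` held at `τ` satisfy the
same equations, so they coincide. This turns a joint event into separate conditions on the equations
of `T`, which can then be sorted by the noise they use. -/
theorem observed_eq_on_iff (T : Finset V) (τ : (v : V) → Dom v) (u : (i : U) → DomU i) :
    (∀ v ∈ T, M.observed u v = τ v) ↔ ∀ v ∈ T, M.natural T τ u v = τ v := by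
  constructor
  · intro h v hv
    have : M.potential T (T.restrict τ) u = M.observed u := by
      refine M.potential_unique _ _ _ _ fun w => ?_
      split_ifs with hw
      · exact h w hw
      · exact M.observed_eq u w
    rw [natural, this, ← observed_eq, h v hv]
  · intro h v hv
    have : M.observed u = M.potential T (T.restrict τ) u := by
      refine M.potential_unique _ _ _ _ fun w => ?_
      rw [dif_neg (Finset.notMem_empty w)]
      by_cases hw : w ∈ T
      · rw [potential_restrict_of_mem M τ u hw, ← h w hw, natural]
      · rw [potential_restrict_of_notMem M τ u hw, natural]
    rw [this, potential_restrict_of_mem M τ u hv]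

theorem potential_eq_observed_of_mem_ev {X : Finset V} {x : DomOf Dom X} {u : (i : U) → DomU i}
    (h : u ∈ M.ev X x) : M.potential X x u = M.observed u := by
  refine M.potential_unique _ _ _ _ fun v => ?_
  split_ifs with hv
  · exact congrFun h ⟨v, hv⟩
  · exact M.observed_eq u v

theorem decEv_inter_eq {X I : Finset V} {f : DomOf Dom I → Bool} {x : DomOf Dom X} {A : Set ((i : U) → DomU i)}
    (hA : A ⊆ M.ev X x) (d : Bool) : M.decEv f d ∩ A = M.decEvDo f X x d ∩ A := by
  ext u
  refine and_congr_left fun hu => ?_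
  simp only [decEv, decEvDo, Set.mem_ofPred_eq, M.potential_eq_observed_of_mem_ev (hA hu)]

theorem potential_eq_observed_of_not_descendant {X : Finset V} (x : DomOf Dom X)
    (u : (i : U) → DomU i) {v : V} (hvX : v ∉ X)
    (hv : ∀ a ∈ X, ¬ G.Descendant (Sum.inl a) (Sum.inl v)) :
    M.potential X x u v = M.observed u v := by
  induction v using G.wf_paV.induction with
  | _ v ih =>
    rw [potential_eq, dif_neg hvX, observed_eq]
    congr 1
    funext w
    have e : G.Edge (Sum.inl w.1) (Sum.inl v) := w.2
    exact ih w w.2 (fun hw => hv w hw (.single e)) fun a ha hd => hv a ha (hd.tail e)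

variable {X Z : Finset V}

/-- The intervention on `X` does not move the non-descendants `Z`, so holding them at their observed
values changes nothing. -/
theorem potential_eq_potential_union {τ : (v : V) → Dom v} {u : (i : U) → DomU i}
    (hZ : ∀ a ∈ X, ∀ z ∈ Z, ¬ G.Descendant (Sum.inl a) (Sum.inl z))
    (hu : ∀ v ∈ Z, M.observed u v = τ v) :
    M.potential X (X.restrict τ) u = M.potential (X ∪ Z) ((X ∪ Z).restrict τ) u := by
  refine (M.potential_unique _ _ _ _ fun v => ?_).symm
  by_cases hvX : v ∈ X
  · rw [dif_pos (Finset.mem_union_left _ hvX), potential_restrict_of_mem M τ u hvX]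
    rfl
  · by_cases hvZ : v ∈ Z
    · rw [dif_pos (Finset.mem_union_right _ hvZ),
        potential_eq_observed_of_not_descendant M _ u hvX fun a ha => hZ a ha v hvZ, hu v hvZ]
      rfl
    · rw [dif_neg (by simp [hvX, hvZ]), potential_eq, dif_neg hvX]

theorem natural_congr_of_not_descendant {τ τ' : (v : V) → Dom v} (u : (i : U) → DomU i)
    (hτ : ∀ v ∈ Z, τ v = τ' v) {v : V} (hv : ∀ a ∈ X, ¬ G.Descendant (Sum.inl a) (Sum.inl v)) :
    M.natural (X ∪ Z) τ u v = M.natural (X ∪ Z) τ' u v := by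
  induction v using G.wf_paV.induction with
  | _ v ih =>
    unfold natural
    congr 1
    funext w
    have e : G.Edge (Sum.inl w.1) (Sum.inl v) := w.2
    by_cases hw : w.1 ∈ X ∪ Z
    · rw [potential_restrict_of_mem M _ u hw, potential_restrict_of_mem M _ u hw]
      rcases Finset.mem_union.1 hw with hw | hw
      · exact (hv w hw (.single e)).elim
      · exact hτ w hw
    · rw [potential_restrict_of_notMem M _ u hw, potential_restrict_of_notMem M _ u hw]
      exact ih w w.2 fun a ha hd => hv a ha (hd.tail e)

/-- With `X ∪ Z` fixed, noise enters only through ancestors joined to `v` by directed paths avoiding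
`X ∪ Z`; `Reach.up` propagates reachability along all of them. -/
theorem dependsOn_natural_of_reach (τ : (v : V) → Dom v) {v : V}
    (hv : ∀ m, G.Edge m (Sum.inl v) → (∀ a ∈ X, m ≠ Sum.inl a) → G.Reach X Z m true) :
    DependsOn (fun u => M.natural (X ∪ Z) τ u v) {i | G.Reach X Z (Sum.inr i) true} := by
  intro u u' huu
  induction v using G.wf_paV.induction with
  | _ v ih =>
    simp only [natural]
    congr 1
    · funext w
      have e : G.Edge (Sum.inl w.1) (Sum.inl v) := w.2
      by_cases hw : w.1 ∈ X ∪ Z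
      · rw [potential_restrict_of_mem M _ u hw, potential_restrict_of_mem M _ u' hw]
      · rw [potential_restrict_of_notMem M _ u hw, potential_restrict_of_notMem M _ u' hw]
        rw [Finset.mem_union, not_or] at hw
        have hr := hv _ e fun a ha h => hw.1 (Sum.inl.inj h ▸ ha)
        exact ih w w.2 fun m hm hX =>
          hr.up (fun z hz h => hw.2 (Sum.inl.inj h ▸ hz)) hm hX
    · funext i
      have e : G.Edge (Sum.inr i.1) (Sum.inl v) := i.2
      exact huu i (hv _ e (by simp))

/-- If some relevant noise were reached, `Reach.down` would carry the walk from it to `v` through an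
incoming arrow. -/
theorem dependsOn_natural_of_not_reach (τ : (v : V) → Dom v) {v : V} (hvX : v ∉ X)
    (hv : ¬ G.Reach X Z (Sum.inl v) false) :
    DependsOn (fun u => M.natural (X ∪ Z) τ u v) {i | G.Reach X Z (Sum.inr i) true}ᶜ := by
  intro u u' huu
  induction v using G.wf_paV.induction with
  | _ v ih =>
    have hne : ∀ a ∈ X, (Sum.inl v : V ⊕ U) ≠ Sum.inl a := fun a ha h => hvX (Sum.inl.inj h ▸ ha)
    simp only [natural]
    congr 1
    · funext w
      have e : G.Edge (Sum.inl w.1) (Sum.inl v) := w.2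
      by_cases hw : w.1 ∈ X ∪ Z
      · rw [potential_restrict_of_mem M _ u hw, potential_restrict_of_mem M _ u' hw]
      · rw [potential_restrict_of_notMem M _ u hw, potential_restrict_of_notMem M _ u' hw]
        rw [Finset.mem_union, not_or] at hw
        exact ih w w.2 hw.1 fun hr =>
          hv (hr.down (fun z hz h => hw.2 (Sum.inl.inj h ▸ hz)) e hne)
    · funext i
      have e : G.Edge (Sum.inr i.1) (Sum.inl v) := i.2
      exact huu i fun hr => hv (hr.down (by simp) e hne)

end Interventions

/-! ### Independence of events with disjoint noise, and the factorization. -/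

section Independence

variable [Fintype U] [DecidableEq U] [∀ i, Fintype (DomU i)] (M : PCM G Dom DomU)

theorem sum_prob : ∑ u, (M.prob u).toReal = 1 := by
  rw [← ENNReal.toReal_sum fun u _ => M.prob.apply_ne_top u, ← tsum_fintype (L := .unconditional _),
    M.prob.tsum_coe,
    ENNReal.toReal_one]

/-- Take two independent copies of the noise and exchange their coordinates outside `S`. This
preserves the product weight and turns "the first copy is in `A ∩ B`" into "the first is in `A` and
the second in `B`". -/
theorem ExogenousIndependent.Pr_inter {M : PCM G Dom DomU} (hM : M.ExogenousIndependent)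
    {A B : Set ((i : U) → DomU i)} {S : Set U} (hA : DependsOn (· ∈ A) S)
    (hB : DependsOn (· ∈ B) Sᶜ) : M.Pr (A ∩ B) = M.Pr A * M.Pr B := by
  classical
  let mix : ((i : U) → DomU i) × ((i : U) → DomU i) → ((i : U) → DomU i) × ((i : U) → DomU i) :=
    fun p => (S.piecewise p.1 p.2, S.piecewise p.2 p.1)
  have hmix : Function.Involutive mix := fun p => by
    ext i <;> by_cases hi : i ∈ S <;> simp [mix, hi]
  have hprob : ∀ p, (M.prob (mix p).1).toReal * (M.prob (mix p).2).toReal =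
      (M.prob p.1).toReal * (M.prob p.2).toReal := by
    intro p
    simp only [← ENNReal.toReal_mul]
    rw [hM, hM, hM, hM, ← Finset.prod_mul_distrib, ← Finset.prod_mul_distrib]
    congr 1
    refine Finset.prod_congr rfl fun i _ => ?_
    by_cases hi : i ∈ S <;> simp [mix, hi, mul_comm]
  have hAm : ∀ p, ((mix p).1 ∈ A) = (p.1 ∈ A) := fun p => hA fun i hi => by simp [mix, hi]
  have hBm : ∀ p, ((mix p).1 ∈ B) = (p.2 ∈ B) := fun p => hB fun i hi => by
    simp [mix, Set.piecewise_eq_of_notMem _ _ _ hi]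
  calc M.Pr (A ∩ B) = M.Pr (A ∩ B) * ∑ u, (M.prob u).toReal := by rw [sum_prob, mul_one]
    _ = ∑ p : ((i : U) → DomU i) × ((i : U) → DomU i),
        (A ∩ B).indicator (fun u => (M.prob u).toReal) p.1 * (M.prob p.2).toReal := by
      rw [Pr, Finset.sum_mul_sum, Fintype.sum_prod_type]
    _ = ∑ p : ((i : U) → DomU i) × ((i : U) → DomU i),
        A.indicator (fun u => (M.prob u).toReal) p.1 *
          B.indicator (fun u => (M.prob u).toReal) p.2 := by
      refine (Fintype.sum_equiv hmix.toPerm _ _ fun p => ?_).symm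
      simp only [Function.Involutive.coe_toPerm, Set.indicator_apply, Set.mem_inter_iff, hAm, hBm]
      by_cases h1 : p.1 ∈ A <;> by_cases h2 : p.2 ∈ B <;> simp [h1, h2, hprob]
    _ = M.Pr A * M.Pr B := by
      rw [Pr, Pr, Finset.sum_mul_sum, Fintype.sum_prod_type]

variable {M} [Finite V] [DecidableEq V] {X Z I : Finset V}

/-- Given `Z`, the counterfactual decision under an intervention on `X` is independent of the
observed value of `X`. -/
theorem ExogenousIndependent.exists_factorization (hM : M.ExogenousIndependent)
    (hZX : Disjoint Z X) (hback : G.BackdoorCriterion X (I \ (X ∪ Z)) Z)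
    (f : DomOf Dom I → Bool) (τ₀ : (v : V) → Dom v) (d : Bool) :
    ∃ (α : DomOf Dom X → ℝ) (β γ : ℝ), ∀ τ : (v : V) → Dom v, (∀ v ∈ Z, τ v = τ₀ v) →
      M.Pr {u | ∀ v ∈ X ∪ Z, M.observed u v = τ v} = α (X.restrict τ) * β ∧
      M.Pr (M.decEvDo f X (X.restrict τ₀) d ∩ {u | ∀ v ∈ X ∪ Z, M.observed u v = τ v}) =
        α (X.restrict τ) * γ := by
  classical
  let S : Set U := {i | G.Reach X Z (Sum.inr i) true}
  -- The values on `Z` come from `τ₀`, so this event varies with `x` alone. It contains the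
  -- equations that use noise in `S`; `B` and `E` use only the rest.
  let A : DomOf Dom X → Set ((i : U) → DomU i) := fun x =>
    let τ : (v : V) → Dom v := fun v => if h : v ∈ X then x ⟨v, h⟩ else τ₀ v
    {u | ∀ v ∈ X ∪ Z, (v ∈ X ∨ G.Reach X Z (Sum.inl v) false) →
      M.natural (X ∪ Z) τ u v = τ v}
  let B : Set ((i : U) → DomU i) :=
    {u | ∀ v ∈ Z, ¬ G.Reach X Z (Sum.inl v) false → M.natural (X ∪ Z) τ₀ u v = τ₀ v}
  let E : Set ((i : U) → DomU i) :=
    {u | f (I.restrict (M.potential (X ∪ Z) ((X ∪ Z).restrict τ₀) u)) = d}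
  have hnotX : ∀ v ∈ Z, v ∉ X := fun v hv hvX => Finset.disjoint_left.1 hZX hv hvX
  have hA : ∀ x, DependsOn (· ∈ A x) S := by
    intro x u u' huu
    refine forall_congr fun v => forall_congr fun hv => forall_congr fun h => ?_
    congr 1
    refine M.dependsOn_natural_of_reach _ (fun m hm hX => ?_) huu
    by_cases hvX : v ∈ X
    · exact .start hvX hm hX
    · exact .collide (h.resolve_left hvX) ((Finset.mem_union.1 hv).resolve_left hvX) hm hX
  have hB : DependsOn (· ∈ B) Sᶜ := by
    intro u u' huu
    refine forall_congr fun v => forall_congr fun hv => forall_congr fun h => ?_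
    congr 1
    exact M.dependsOn_natural_of_not_reach _ (hnotX v hv) h huu
  have hE : DependsOn (· ∈ E) Sᶜ := by
    intro u u' huu
    have : I.restrict (M.potential (X ∪ Z) ((X ∪ Z).restrict τ₀) u) =
        I.restrict (M.potential (X ∪ Z) ((X ∪ Z).restrict τ₀) u') := by
      funext v
      simp only [Finset.restrict]
      by_cases hv : v.1 ∈ X ∪ Z
      · rw [potential_restrict_of_mem M _ u hv, potential_restrict_of_mem M _ u' hv]
      · rw [potential_restrict_of_notMem M _ u hv, potential_restrict_of_notMem M _ u' hv]
        exact M.dependsOn_natural_of_not_reach τ₀ (fun h => hv (Finset.mem_union_left _ h))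
          -- Only inputs outside `X ∪ Z` need separation; the others are constants here.
          (hback.not_reach (Finset.mem_sdiff.2 ⟨v.2, hv⟩) _) huu
    simp only [E, Set.mem_ofPred_eq, this]
  have hBE : DependsOn (· ∈ B ∩ E) Sᶜ := fun u u' huu => by
    simp only [Set.mem_inter_iff]
    exact congrArg₂ And (hB huu) (hE huu)
  refine ⟨fun x => M.Pr (A x), M.Pr B, M.Pr (B ∩ E), fun τ hτ => ?_⟩
  have hset : {u | ∀ v ∈ X ∪ Z, M.observed u v = τ v} = A (X.restrict τ) ∩ B := by
    ext u
    have hτ' : (X ∪ Z).restrict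
        (fun v => if h : v ∈ X then X.restrict τ ⟨v, h⟩ else τ₀ v) = (X ∪ Z).restrict τ := by
      funext v
      simp only [Finset.restrict]
      split_ifs with h
      · rfl
      · exact (hτ v ((Finset.mem_union.1 v.2).resolve_left h)).symm
    have hval : ∀ v ∈ X ∪ Z,
        (if h : v ∈ X then X.restrict τ ⟨v, h⟩ else τ₀ v) = τ v := fun v hv =>
      congrFun hτ' ⟨v, hv⟩
    have hAu : u ∈ A (X.restrict τ) ↔ ∀ v ∈ X ∪ Z,
        (v ∈ X ∨ G.Reach X Z (Sum.inl v) false) → M.natural (X ∪ Z) τ u v = τ v := by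
      refine forall₃_congr fun v hv _ => ?_
      simp only [natural]
      rw [hτ', hval v hv]
    have hBu : u ∈ B ↔
        ∀ v ∈ Z, ¬ G.Reach X Z (Sum.inl v) false → M.natural (X ∪ Z) τ u v = τ v := by
      refine forall₃_congr fun v hv _ => ?_
      -- `τ` and `τ₀` may differ on `X`, but no node of `Z` is downstream of `X`; hence `β` and `γ`
      -- do not depend on the observed treatment.
      rw [M.natural_congr_of_not_descendant u hτ fun a ha => hback.1 a ha v hv, hτ v hv]
    rw [Set.mem_inter_iff, hAu, hBu, Set.mem_ofPred_eq, observed_eq_on_iff]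
    refine ⟨fun h => ⟨fun v hv _ => h v hv, fun v hv _ => h v (Finset.mem_union_right _ hv)⟩,
      fun ⟨h1, h2⟩ v hv => ?_⟩
    by_cases hc : v ∈ X ∨ G.Reach X Z (Sum.inl v) false
    · exact h1 v hv hc
    · rw [not_or] at hc
      exact h2 v ((Finset.mem_union.1 hv).resolve_left hc.1) hc.2
  have hset' : M.decEvDo f X (X.restrict τ₀) d ∩ {u | ∀ v ∈ X ∪ Z, M.observed u v = τ v} =
      A (X.restrict τ) ∩ (B ∩ E) := by
    rw [← Set.inter_assoc, ← hset, Set.inter_comm]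
    ext u
    refine and_congr_right fun hu => ?_
    simp only [decEvDo, E, Set.mem_ofPred_eq]
    rw [M.potential_eq_potential_union hback.1 fun v hv =>
      (hu v (Finset.mem_union_right _ hv)).trans (hτ v hv)]
  rw [hset', hset]
  exact ⟨hM.Pr_inter (hA _) hB, hM.Pr_inter (hA _) hBE⟩

end Independence

end PCM

namespace PCM

variable {V : Type u₁} {U : Type u₂} {G : CausalDiagram V U}
  {Dom : V → Type u₃} {DomU : U → Type u₄}

/-! ### Adjustment formulas and the effect of monotonicity. -/

section Adjustment

variable [Fintype U] [DecidableEq U] [∀ i, Fintype (DomU i)] {M : PCM G Dom DomU}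

theorem Pr_nonneg (A : Set ((i : U) → DomU i)) : 0 ≤ M.Pr A :=
  Finset.sum_nonneg fun _ _ => Set.indicator_nonneg (fun _ _ => ENNReal.toReal_nonneg) _

theorem Pr_mono {A B : Set ((i : U) → DomU i)} (h : A ⊆ B) : M.Pr A ≤ M.Pr B :=
  Finset.sum_le_sum fun _ _ =>
    Set.indicator_le_indicator_of_subset h (fun _ => ENNReal.toReal_nonneg) _

theorem Pr_congr_of_prob_ne_zero {A B : Set ((i : U) → DomU i)}
    (h : ∀ u, M.prob u ≠ 0 → (u ∈ A ↔ u ∈ B)) : M.Pr A = M.Pr B := by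
  classical
  refine Finset.sum_congr rfl fun u _ => ?_
  by_cases hu : M.prob u = 0
  · simp [Set.indicator_apply, hu]
  · simp only [Set.indicator_apply, h u hu]

theorem Pr_eq_add_of_fibers (g : ((i : U) → DomU i) → Bool) (d : Bool)
    (A : Set ((i : U) → DomU i)) :
    M.Pr A = M.Pr ({u | g u = d} ∩ A) + M.Pr ({u | g u = !d} ∩ A) := by
  classical
  rw [Pr, Pr, Pr, ← Finset.sum_add_distrib]
  refine Finset.sum_congr rfl fun u _ => ?_
  by_cases hA : u ∈ A <;> cases hg : g u <;> cases d <;> simp [hA, hg]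

variable [Fintype V] [DecidableEq V] {X K C I : Finset V}

theorem Pr_eq_sum_ev_inter [∀ v, Fintype (Dom v)] (S : Finset V) (A : Set ((i : U) → DomU i)) :
    M.Pr A = ∑ s : DomOf Dom S, M.Pr (M.ev S s ∩ A) := by
  classical
  simp only [Pr]
  rw [Finset.sum_comm]
  refine Finset.sum_congr rfl fun u _ => ?_
  rw [Finset.sum_eq_single (S.restrict (M.observed u))]
  · simp [Set.indicator_apply, ev]
  · intro s _ hs
    simp [ev, hs.symm]
  · simp

/-- The probability that the decision under the intervention `x` is `d` and is changed by the
intervention `y`, where the decision can be changed only in this direction. -/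
theorem Pr_decEvDo_inter_decEvDo {f : DomOf Dom I → Bool} {x y : DomOf Dom X} {d : Bool}
    (h : ∀ u, M.prob u ≠ 0 → f (I.restrict (M.potential X x u)) = (!d) →
      f (I.restrict (M.potential X y u)) = !d) (A : Set ((i : U) → DomU i)) :
    M.Pr (M.decEvDo f X y (!d) ∩ (M.decEvDo f X x d ∩ A)) =
      M.Pr (M.decEvDo f X y (!d) ∩ A) - M.Pr (M.decEvDo f X x (!d) ∩ A) := by
  rw [Pr_eq_add_of_fibers (fun u => f (I.restrict (M.potential X x u))) d
    (M.decEvDo f X y (!d) ∩ A), eq_sub_iff_add_eq]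
  congr 1
  · rw [Set.inter_left_comm]
    rfl
  · refine Pr_congr_of_prob_ne_zero fun u hu => ⟨fun hA => ⟨hA.1, h u hu hA.1, hA.2⟩,
      fun hA => ⟨hA.1, hA.2.2⟩⟩

theorem ExogenousIndependent.exists_factorization_ev (hM : M.ExogenousIndependent)
    (hKX : Disjoint K X) (hC : Disjoint C (K ∪ X))
    (hback : G.BackdoorCriterion X (I \ (X ∪ (C ∪ K))) (C ∪ K))
    (f : DomOf Dom I → Bool) (x₀ : DomOf Dom X) (c : DomOf Dom C) (k : DomOf Dom K) (d : Bool) :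
    ∃ (α : DomOf Dom X → ℝ) (β γ : ℝ), ∀ x : DomOf Dom X,
      M.Pr (M.ev C c ∩ M.ev X x ∩ M.ev K k) = α x * β ∧
      M.Pr (M.decEvDo f X x₀ d ∩ (M.ev C c ∩ M.ev X x ∩ M.ev K k)) = α x * γ := by
  -- Any context serves: its observed values fill in the coordinates outside `X ∪ C ∪ K`, where no
  -- value is prescribed.
  obtain ⟨u, -⟩ := M.prob.support_nonempty
  rw [Finset.disjoint_union_right] at hC
  let τ : DomOf Dom X → (v : V) → Dom v := fun x v =>
    if h : v ∈ X then x ⟨v, h⟩ else if h : v ∈ C then c ⟨v, h⟩ else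
      if h : v ∈ K then k ⟨v, h⟩ else M.observed u v
  have hτX : ∀ x, X.restrict (τ x) = x := fun x => by
    funext v
    simp [τ, Finset.restrict]
  have hτC : ∀ x, C.restrict (τ x) = c := fun x => by
    funext v
    simp [τ, Finset.restrict, Finset.disjoint_left.1 hC.2 v.2]
  have hτK : ∀ x, K.restrict (τ x) = k := fun x => by
    funext v
    simp [τ, Finset.restrict, Finset.disjoint_left.1 hKX v.2,
      Finset.disjoint_right.1 hC.1 v.2]
  obtain ⟨α, β, γ, h⟩ := hM.exists_factorization
    (Finset.disjoint_union_left.2 ⟨hC.2, hKX⟩) hback f (τ x₀) d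
  refine ⟨α, β, γ, fun x => ?_⟩
  have hset : {u | ∀ v ∈ X ∪ (C ∪ K), M.observed u v = τ x v} =
      M.ev C c ∩ M.ev X x ∩ M.ev K k := by
    ext u
    have hev : ∀ (S : Finset V) (s : DomOf Dom S), S.restrict (τ x) = s →
        (u ∈ M.ev S s ↔ ∀ v ∈ S, M.observed u v = τ x v) := by
      rintro S s rfl
      simp [ev, funext_iff, Finset.restrict]
    rw [Set.mem_inter_iff, Set.mem_inter_iff, hev X x (hτX x), hev C c (hτC x), hev K k (hτK x)]
    simp only [Set.mem_ofPred_eq, Finset.forall_mem_union]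
    tauto
  have hx := h (τ x) fun v hv => by
    have : v ∉ X := by
      rcases Finset.mem_union.1 hv with hv | hv
      · exact Finset.disjoint_left.1 hC.2 hv
      · exact Finset.disjoint_left.1 hKX hv
    simp [τ, this]
  rwa [hset, hτX, hτX] at hx

/-- By consistency and the factorization, the conditional probability is `α(x) γ / (α(x) β) = γ /
β`, whatever the treatment; multiplication by `α(y) β` leaves `α(y) γ`. A stratum of weight zero
makes both sides vanish. -/
theorem ExogenousIndependent.condPr_mul_Pr (hM : M.ExogenousIndependent)
    (hKX : Disjoint K X) (hC : Disjoint C (K ∪ X))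
    (hback : G.BackdoorCriterion X (I \ (X ∪ (C ∪ K))) (C ∪ K))
    (f : DomOf Dom I → Bool) (x y : DomOf Dom X) (c : DomOf Dom C) (k : DomOf Dom K) (d : Bool)
    (hpos : 0 < M.Pr (M.ev C c ∩ M.ev X y ∩ M.ev K k) →
      0 < M.Pr (M.ev C c ∩ M.ev X x ∩ M.ev K k)) :
    M.condPr (M.decEv f d) (M.ev C c ∩ M.ev X x ∩ M.ev K k) *
        M.Pr (M.ev C c ∩ M.ev X y ∩ M.ev K k) =
      M.Pr (M.decEvDo f X x d ∩ (M.ev C c ∩ M.ev X y ∩ M.ev K k)) := by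
  rcases (Pr_nonneg (M.ev C c ∩ M.ev X y ∩ M.ev K k)).eq_or_lt with h0 | h0
  · rw [← h0, mul_zero]
    exact le_antisymm (Pr_nonneg _) (h0 ▸ Pr_mono Set.inter_subset_right)
  · obtain ⟨α, β, γ, h⟩ := hM.exists_factorization_ev hKX hC hback f x c k d
    have hx := (hpos h0).ne'
    rw [condPr, M.decEv_inter_eq (x := x) (fun u hu => hu.1.2), (h x).2, (h y).2, (h y).1, (h x).1]
    rw [(h x).1] at hx
    have h1 := left_ne_zero_of_mul hx
    have h2 := right_ne_zero_of_mul hx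
    field_simp

variable [∀ v, Fintype (Dom v)]

/-- Adjustment formula for the effect of the treatment `x` on those who received `y`. -/
theorem ExogenousIndependent.sum_condPr_mul_condPr (hM : M.ExogenousIndependent)
    (hKX : Disjoint K X) (hC : Disjoint C (K ∪ X))
    (hback : G.BackdoorCriterion X (I \ (X ∪ (C ∪ K))) (C ∪ K))
    (f : DomOf Dom I → Bool) (x y : DomOf Dom X) (k : DomOf Dom K) (d : Bool)
    (hpos : ∀ c : DomOf Dom C, 0 < M.Pr (M.ev C c ∩ M.ev X y ∩ M.ev K k) →
      0 < M.Pr (M.ev C c ∩ M.ev X x ∩ M.ev K k)) :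
    ∑ c : DomOf Dom C, M.condPr (M.decEv f d) (M.ev C c ∩ M.ev X x ∩ M.ev K k) *
        M.condPr (M.ev C c) (M.ev X y ∩ M.ev K k) =
      M.condPr (M.decEvDo f X x d) (M.ev X y ∩ M.ev K k) := by
  rw [condPr, Pr_eq_sum_ev_inter C, Finset.sum_div]
  refine Finset.sum_congr rfl fun c _ => ?_
  rw [condPr.eq_1 M (M.ev C c), ← Set.inter_assoc, ← mul_div_assoc,
    hM.condPr_mul_Pr hKX hC hback f x y c k d (hpos c), Set.inter_assoc (M.ev C c),
    Set.inter_left_comm _ (M.ev C c)]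

/-- Adjustment formula for the effect of the treatment `x` in the subpopulation `k`. -/
theorem ExogenousIndependent.sum_condPr_mul_condPr_ev (hM : M.ExogenousIndependent)
    (hKX : Disjoint K X) (hC : Disjoint C (K ∪ X))
    (hback : G.BackdoorCriterion X (I \ (X ∪ (C ∪ K))) (C ∪ K))
    (f : DomOf Dom I → Bool) (x : DomOf Dom X) (k : DomOf Dom K) (d : Bool)
    (hpos : ∀ c : DomOf Dom C, 0 < M.Pr (M.ev C c ∩ M.ev K k) →
      0 < M.Pr (M.ev C c ∩ M.ev X x ∩ M.ev K k)) :
    ∑ c : DomOf Dom C, M.condPr (M.decEv f d) (M.ev C c ∩ M.ev X x ∩ M.ev K k) *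
        M.condPr (M.ev C c) (M.ev K k) =
      M.condPr (M.decEvDo f X x d) (M.ev K k) := by
  rw [condPr, Pr_eq_sum_ev_inter C, Finset.sum_div]
  refine Finset.sum_congr rfl fun c _ => ?_
  rw [condPr.eq_1 M (M.ev C c), ← mul_div_assoc]
  congr 1
  have hset : ∀ y, M.ev X y ∩ (M.ev C c ∩ M.ev K k) = M.ev C c ∩ M.ev X y ∩ M.ev K k := fun y => by
    rw [Set.inter_left_comm, Set.inter_assoc]
  -- Both sides are split by the observed treatment `y`, and the formula is applied to each `y`.
  rw [Pr_eq_sum_ev_inter X (M.ev C c ∩ M.ev K k), Finset.mul_sum, Set.inter_left_comm,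
    Pr_eq_sum_ev_inter X]
  refine Finset.sum_congr rfl fun y _ => ?_
  rw [hset, Set.inter_left_comm _ (M.decEvDo f X x d), hset]
  exact hM.condPr_mul_Pr hKX hC hback f x y c k d fun h =>
    hpos c (h.trans_le (Pr_mono fun u hu => ⟨hu.1.1, hu.2⟩))

/-- The probability that the intervention `y` changes the decision `d`, given that decision. -/
theorem ExogenousIndependent.condPr_decEvDo_eq (hM : M.ExogenousIndependent)
    (hKX : Disjoint K X) (hC : Disjoint C (K ∪ X))
    (hback : G.BackdoorCriterion X (I \ (X ∪ (C ∪ K))) (C ∪ K))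
    {f : DomOf Dom I → Bool} {x y : DomOf Dom X} (k : DomOf Dom K) {d : Bool}
    (h : ∀ u, M.prob u ≠ 0 → f (I.restrict (M.potential X x u)) = (!d) →
      f (I.restrict (M.potential X y u)) = !d)
    (h0 : 0 < M.Pr (M.ev X x ∩ M.decEv f d ∩ M.ev K k))
    (hpos : ∀ c : DomOf Dom C, 0 < M.Pr (M.ev C c ∩ M.ev X x ∩ M.ev K k) →
      0 < M.Pr (M.ev C c ∩ M.ev X y ∩ M.ev K k)) :
    M.condPr (M.decEvDo f X y (!d)) (M.ev X x ∩ M.decEv f d ∩ M.ev K k) =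
      ((∑ c : DomOf Dom C,
          M.condPr (M.decEv f (!d)) (M.ev C c ∩ M.ev X y ∩ M.ev K k) *
            M.condPr (M.ev C c) (M.ev X x ∩ M.ev K k)) -
        M.condPr (M.decEv f (!d)) (M.ev X x ∩ M.ev K k)) /
      M.condPr (M.decEv f d) (M.ev X x ∩ M.ev K k) := by
  have hsub : M.ev X x ∩ M.ev K k ⊆ M.ev X x := Set.inter_subset_left
  rw [hM.sum_condPr_mul_condPr hKX hC hback f y x k _ hpos]
  have hset : M.ev X x ∩ M.decEv f d ∩ M.ev K k =
      M.decEvDo f X x d ∩ (M.ev X x ∩ M.ev K k) := by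
    rw [← M.decEv_inter_eq hsub, Set.inter_left_comm, Set.inter_assoc]
  rw [hset] at h0 ⊢
  have hne := (h0.trans_le (Pr_mono Set.inter_subset_right)).ne'
  simp only [condPr]
  rw [Pr_decEvDo_inter_decEvDo h, M.decEv_inter_eq hsub, M.decEv_inter_eq hsub, ← sub_div,
    div_div_div_cancel_right₀ hne]

end Adjustment

end PCM

theorem proposition2 {V : Type u₁} {U : Type u₂} [Fintype V] [DecidableEq V]
    [Fintype U] [DecidableEq U] {Dom : V → Type u₃} {DomU : U → Type u₄}
    [∀ v, Fintype (Dom v)] [∀ i, Fintype (DomU i)]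
    (G : CausalDiagram V U) (M : PCM G Dom DomU) (hU : M.ExogenousIndependent)
    (I : Finset V) (f : DomOf Dom I → Bool)
    (X K C : Finset V) (hKX : Disjoint K X) (hC : Disjoint C (K ∪ X))
    (x x' : DomOf Dom X) (k : DomOf Dom K)
    (hmono : M.MonotoneRel f X x x')
    -- inputs in `X` (held fixed) or in `C ∪ K` (conditioned on) need not be separated from `X`
    (hback : G.BackdoorCriterion X (I \ (X ∪ (C ∪ K))) (C ∪ K)) :
    (0 < M.Pr (M.ev X x ∩ M.decEv f true ∩ M.ev K k) →
      (∀ c : DomOf Dom C, 0 < M.Pr (M.ev C c ∩ M.ev X x ∩ M.ev K k) →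
        0 < M.Pr (M.ev C c ∩ M.ev X x' ∩ M.ev K k)) →
      M.Nec f x x' k =
        ((∑ c : DomOf Dom C,
            M.condPr (M.decEv f false) (M.ev C c ∩ M.ev X x' ∩ M.ev K k) *
              M.condPr (M.ev C c) (M.ev X x ∩ M.ev K k)) -
          M.condPr (M.decEv f false) (M.ev X x ∩ M.ev K k)) /
        M.condPr (M.decEv f true) (M.ev X x ∩ M.ev K k)) ∧
    (0 < M.Pr (M.ev X x' ∩ M.decEv f false ∩ M.ev K k) →
      (∀ c : DomOf Dom C, 0 < M.Pr (M.ev C c ∩ M.ev X x' ∩ M.ev K k) →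
        0 < M.Pr (M.ev C c ∩ M.ev X x ∩ M.ev K k)) →
      M.Suf f x x' k =
        ((∑ c : DomOf Dom C,
            M.condPr (M.decEv f true) (M.ev C c ∩ M.ev X x ∩ M.ev K k) *
              M.condPr (M.ev C c) (M.ev X x' ∩ M.ev K k)) -
          M.condPr (M.decEv f true) (M.ev X x' ∩ M.ev K k)) /
        M.condPr (M.decEv f false) (M.ev X x' ∩ M.ev K k)) ∧
    (0 < M.Pr (M.ev K k) →
      (∀ c : DomOf Dom C, 0 < M.Pr (M.ev C c ∩ M.ev K k) →
        0 < M.Pr (M.ev C c ∩ M.ev X x ∩ M.ev K k) ∧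
        0 < M.Pr (M.ev C c ∩ M.ev X x' ∩ M.ev K k)) →
      M.NeSuf f x x' k =
        ∑ c : DomOf Dom C,
          (M.condPr (M.decEv f true) (M.ev C c ∩ M.ev X x ∩ M.ev K k) -
            M.condPr (M.decEv f true) (M.ev C c ∩ M.ev X x' ∩ M.ev K k)) *
          M.condPr (M.ev C c) (M.ev K k)) := by
  refine ⟨fun h0 hpos => ?_, fun h0 hpos => ?_, fun h0 hpos => ?_⟩
  · refine hU.condPr_decEvDo_eq hKX hC hback k (d := true) (fun u hu h => ?_) h0 hpos
    have := hmono u hu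
    rw [h] at this
    exact le_bot_iff.1 this
  -- Sufficiency is necessity with the two treatments and the two decisions exchanged.
  · refine hU.condPr_decEvDo_eq hKX hC hback k (d := false) (fun u hu h => ?_) h0 hpos
    have := hmono u hu
    rw [h] at this
    exact top_le_iff.1 this
  · simp only [sub_mul, Finset.sum_sub_distrib]
    rw [hU.sum_condPr_mul_condPr_ev hKX hC hback f x k true fun c hc => (hpos c hc).1,
      hU.sum_condPr_mul_condPr_ev hKX hC hback f x' k true fun c hc => (hpos c hc).2,
      PCM.NeSuf, PCM.condPr, PCM.condPr, PCM.condPr, ← sub_div, Set.inter_assoc]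
    congr 1
    -- Here `x'` is the initial intervention: a positive decision under `x'` stays positive under
    -- `x`.
    refine PCM.Pr_decEvDo_inter_decEvDo (d := false) (fun u hu h => ?_) _
    have := hmono u hu
    rw [h] at this
    exact top_le_iff.1 this
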